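/- Let $X$ and $Y$ be Banach spaces and let $\|\cdot\|_Z$ be a strictly monotone norm on $\mathbb{R}^2$, that is, $\|(x_1,y_1)\|_Z<\|(x_2,y_2)\|_Z$ whenever $0\le x_1\le x_2$, $0\le y_1<y_2$ or $0\le x_1<x_2$, $0\le y_1\le y_2$. Let $X\oplus_Z Y$ be the space $X\times Y$ with the norm $\|(x,y)\|=\|(\|x\|,\|y\|)\|_Z$. Say that a Banach space $E$ has (a) the weak fixed point property if for every nonempty, weakly compact, convex set $C\subset E$, every mapping $T:C\to C$ with $\|Tx-Ty\|\le\|x-y\|$ for all $x,y\in C$ has a fixed point; (b) the weak Banach–Saks property if every weakly null sequence in $E$ has a subsequence $(x_n)$ with $\lim_{n\to\infty}\left\|\frac1n\sum_{k=1}^n x_k\right\|=0$; (c) property asymptotic (P) if $\liminf_{n\to\infty}\|x_n\|<\operatorname{diam}_a(x_n)$ for every sequence $(x_n)$ in $E$ that converges weakly to $0$ and satisfies $\operatorname{diam}_a(x_n)>0$, where $\operatorname{diam}_a(x_n)=\lim_{n\to\infty}\sup_{k,l\ge n}\|x_k-x_l\|$. If $X$ has the weak Banach–Saks property and the weak fixed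 point property, and $Y$ has property asymptotic (P), then $X\oplus_Z Y$ has the weak fixed point property. -/

import Mathlib

open Filter Topology

/-- The sequence `x` converges to `0` in the weak topology of the real normed space `E`. -/
def WeaklyNull {E : Type*} [NormedAddCommGroup E] [NormedSpace ℝ E] (x : ℕ → E) : Prop :=
  Tendsto (fun n => toWeakSpace ℝ E (x n)) atTop (𝓝 (toWeakSpace ℝ E 0))

/-- The weak fixed point property: every nonexpansive self-mapping of a nonempty, convex and
weakly compact set has a fixed point. (The values of `T` outside `C` play no role.) -/
def HasWFPP (E : Type*) [NormedAddCommGroup E] [NormedSpace ℝ E] : Prop :=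
  ∀ C : Set E, C.Nonempty → Convex ℝ C → IsCompact (toWeakSpace ℝ E '' C) →
    ∀ T : E → E, Set.MapsTo T C C → (∀ x ∈ C, ∀ y ∈ C, ‖T x - T y‖ ≤ ‖x - y‖) →
      ∃ x ∈ C, T x = x

/-- The weak Banach--Saks property: every weakly null sequence has a subsequence whose
arithmetic means converge to `0` in norm. -/
def HasWeakBanachSaks (E : Type*) [NormedAddCommGroup E] [NormedSpace ℝ E] : Prop :=
  ∀ w : ℕ → E, WeaklyNull w → ∃ φ : ℕ → ℕ, StrictMono φ ∧
    Tendsto (fun n : ℕ => ‖(1 / (n : ℝ)) • ∑ k ∈ Finset.range n, w (φ k)‖) atTop (𝓝 0)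

/-- `d` is the asymptotic diameter of `x`: the limit, as `n → ∞`, of the diameters of the tails
`{x k : n ≤ k}`. For a bounded sequence this limit exists, as these diameters are finite
and decrease. -/
def IsAsymptoticDiam {E : Type*} [NormedAddCommGroup E] (x : ℕ → E) (d : ℝ) : Prop :=
  Tendsto (fun n => Metric.diam (x '' Set.Ici n)) atTop (𝓝 d)

/-- Property asymptotic (P). Weakly null sequences are bounded, so that the asymptotic diameter
exists and the lower limit is the usual one. -/
def HasAsymptoticP (E : Type*) [NormedAddCommGroup E] [NormedSpace ℝ E] : Prop :=
  ∀ x : ℕ → E, WeaklyNull x → ∀ d : ℝ, IsAsymptoticDiam x d → 0 < d →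
    liminf (fun n => ‖x n‖) atTop < d

/-- A strictly monotone norm on the plane. -/
structure StrictlyMonotoneNorm extends Seminorm ℝ (ℝ × ℝ) where
  eq_zero_of_map_eq_zero : ∀ z : ℝ × ℝ, toFun z = 0 → z = 0
  strict_mono_left : ∀ x₁ x₂ y₁ y₂ : ℝ, 0 ≤ x₁ → x₁ < x₂ → 0 ≤ y₁ → y₁ ≤ y₂ →
    toFun (x₁, y₁) < toFun (x₂, y₂)
  strict_mono_right : ∀ x₁ x₂ y₁ y₂ : ℝ, 0 ≤ x₁ → x₁ ≤ x₂ → 0 ≤ y₁ → y₁ < y₂ →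
    toFun (x₁, y₁) < toFun (x₂, y₂)

theorem StrictlyMonotoneNorm.mono (Z : StrictlyMonotoneNorm) {x₁ x₂ y₁ y₂ : ℝ}
    (hx₁ : 0 ≤ x₁) (hx : x₁ ≤ x₂) (hy₁ : 0 ≤ y₁) (hy : y₁ ≤ y₂) :
    Z.toSeminorm (x₁, y₁) ≤ Z.toSeminorm (x₂, y₂) := by
  rcases hx.lt_or_eq with h | rfl
  · exact (Z.strict_mono_left _ _ _ _ hx₁ h hy₁ hy).le
  · rcases hy.lt_or_eq with h | rfl
    · exact (Z.strict_mono_right _ _ _ _ hx₁ le_rfl hy₁ h).le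
    · exact le_rfl

/-- The underlying vector space `X × Y` of the `Z`-direct sum of `X` and `Y`. -/
def ZSum (_Z : StrictlyMonotoneNorm) (X Y : Type*) : Type _ := X × Y

namespace ZSum

variable (Z : StrictlyMonotoneNorm) (X Y : Type*) [NormedAddCommGroup X] [NormedSpace ℝ X]
  [NormedAddCommGroup Y] [NormedSpace ℝ Y]

/-- Addition is componentwise. -/
instance : AddCommGroup (ZSum Z X Y) := inferInstanceAs (AddCommGroup (X × Y))

/-- Scalar multiplication is componentwise. -/
instance : Module ℝ (ZSum Z X Y) := inferInstanceAs (Module ℝ (X × Y))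

/-- The norm of the `Z`-direct sum: `‖(x, y)‖ = ‖(‖x‖, ‖y‖)‖_Z`. -/
def groupNorm : AddGroupNorm (ZSum Z X Y) where
  toFun v := Z.toSeminorm (‖v.1‖, ‖v.2‖)
  map_zero' := by
    change Z.toSeminorm (‖(0 : X)‖, ‖(0 : Y)‖) = 0
    rw [norm_zero, norm_zero]
    exact map_zero Z.toSeminorm
  add_le' v w := by
    change Z.toSeminorm (‖v.1 + w.1‖, ‖v.2 + w.2‖) ≤ _
    exact (Z.mono (norm_nonneg _) (norm_add_le _ _) (norm_nonneg _) (norm_add_le _ _)).trans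
      (map_add_le_add Z.toSeminorm (‖v.1‖, ‖v.2‖) (‖w.1‖, ‖w.2‖))
  neg' v := by
    change Z.toSeminorm (‖-v.1‖, ‖-v.2‖) = _
    rw [norm_neg, norm_neg]
  eq_zero_of_map_eq_zero' v h := by
    have h0 := Z.eq_zero_of_map_eq_zero _ h
    exact Prod.ext (norm_eq_zero.1 (congrArg Prod.fst h0)) (norm_eq_zero.1 (congrArg Prod.snd h0))

noncomputable instance : NormedAddCommGroup (ZSum Z X Y) :=
  (groupNorm Z X Y).toNormedAddCommGroup

noncomputable instance : NormedSpace ℝ (ZSum Z X Y) where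
  norm_smul_le a v := by
    change Z.toSeminorm (‖a • v.1‖, ‖a • v.2‖) ≤ ‖a‖ * Z.toSeminorm (‖v.1‖, ‖v.2‖)
    rw [norm_smul, norm_smul]
    have h := map_smul_eq_mul Z.toSeminorm ‖a‖ (‖v.1‖, ‖v.2‖)
    rw [norm_norm] at h
    exact h.le

end ZSum

/-!
A minimal invariant set `M` of a nonexpansive mapping `T` in the direct sum of `X` and `Y` turns
out to lie in a single translate of `X`, where the weak fixed point property of `X` gives a fixed
point.

Let `d` be the diameter of `M`. Some sequence of approximate fixed points `w n ∈ M` converges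
weakly to a point `a ∈ M`, and by the Goebel--Karlovitz lemma
(`IsMinimalInvariant.tendsto_norm_sub`) its distances to every point of `M` tend to `d`. Limits are
taken along an ultrafilter. The limits of the norms of the two coordinates of `w n - w m` are at
least those for `w n - a`, and both pairs of limits have `Z`-norm `d`; strict monotonicity makes the
limits for the second coordinates equal, and then property asymptotic (P) of `Y` makes them `0`. So
`(w n).2` tends to `a.2` in norm (`ZSum.tendsto_snd`).

By the weak Banach--Saks property of `X`, for every `ε` there is a `K` such that the mean of
`w n₁, …, w n_K` is `ε`-close to `a` for all sufficiently sparse `n₁, …, n_K`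
(`HasWeakBanachSaks.exists_iteratedSumLE`). This mean arises from `w n₁` by steps that replace the
mean `b` of `j` terms by the point `b'` of the segment from `b` to `w n` at distance `d / (j + 1)`
from `b` and `j * d / (j + 1)` from `w n`. Only these distances are kept (`Reachable`): in each
step `b'` may be any point of `M` that has them. The points of `M` that are reachable in this way,
up to `ε`, form a convex set, which is invariant because `T` is nonexpansive and nearly fixes
`w n`, and which contains `a`. Minimality makes it dense in `M`
(`IsMinimalInvariant.subset_closure_reachable`). On the other hand every step stays near the slice
of second coordinate `a.2`: `b` and `w n` are near that slice, their distance is nearly `d` by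
Goebel--Karlovitz, and a metrically intermediate point with another second coordinate would
contradict strict monotonicity (`StrictlyMonotoneNorm.exists_tolerance`,
`ZSum.norm_snd_le_of_forall_reachable`). As `ε` is arbitrary, all of `M` lies in the slice.
-/

/-! ### The weak topology -/

section WeakTopology

variable {E : Type*} [NormedAddCommGroup E] [NormedSpace ℝ E]

theorem topDualPairing_flip_injective : Function.Injective (topDualPairing ℝ E).flip := by
  intro u v h
  exact (SeparatingDual.eq_iff_forall_dual_eq (R := ℝ)).2 fun f => congrArg (fun g => g f) h

theorem tendsto_toWeakSpace_iff {ι : Type*} {l : Filter ι} {x : ι → E} {a : E} :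
    Tendsto (fun n => toWeakSpace ℝ E (x n)) l (𝓝 (toWeakSpace ℝ E a)) ↔
      ∀ f : StrongDual ℝ E, Tendsto (fun n => f (x n)) l (𝓝 (f a)) := by
  exact WeakBilin.tendsto_iff_forall_eval_tendsto _ topDualPairing_flip_injective

theorem continuous_toWeakSpace : Continuous (toWeakSpace ℝ E) :=
  (toWeakSpaceCLM ℝ E).continuous

theorem continuous_eval_weakSpace (f : StrongDual ℝ E) :
    Continuous (fun u : WeakSpace ℝ E => f ((toWeakSpace ℝ E).symm u)) :=
  WeakBilin.eval_continuous (topDualPairing ℝ E).flip f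

instance : T2Space (WeakSpace ℝ E) := by
  exact (WeakBilin.isEmbedding topDualPairing_flip_injective).t2Space

theorem isClosed_of_isCompact_toWeakSpace {C : Set E} (hC : IsCompact (toWeakSpace ℝ E '' C)) :
    IsClosed C := by
  have h := hC.isClosed.preimage (continuous_toWeakSpace (E := E))
  rwa [Set.preimage_image_eq _ (toWeakSpace ℝ E).injective] at h

theorem isClosed_toWeakSpace_image {D : Set E} (hD : Convex ℝ D) (hDc : IsClosed D) :
    IsClosed (toWeakSpace ℝ E '' D) := by
  have h := hD.toWeakSpace_closure (𝕜 := ℝ)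
  rw [hDc.closure_eq] at h
  rw [h]
  exact isClosed_closure

theorem isCompact_toWeakSpace_of_subset {C D : Set E} (hC : IsCompact (toWeakSpace ℝ E '' C))
    (hDC : D ⊆ C) (hD : Convex ℝ D) (hDc : IsClosed D) : IsCompact (toWeakSpace ℝ E '' D) :=
  hC.of_isClosed_subset (isClosed_toWeakSpace_image hD hDc) (Set.image_mono hDC)

/-- A weakly compact set is bounded, by the uniform boundedness principle on the dual space. -/
theorem isBounded_of_isCompact_toWeakSpace {C : Set E}
    (hC : IsCompact (toWeakSpace ℝ E '' C)) : Bornology.IsBounded C := by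
  have h : ∀ f : StrongDual ℝ E, ∃ B, ∀ x : C,
      ‖NormedSpace.inclusionInDoubleDual ℝ E x f‖ ≤ B := by
    intro f
    obtain ⟨B, hB⟩ := (hC.image (continuous_eval_weakSpace f)).isBounded.exists_norm_le
    refine ⟨B, fun x => ?_⟩
    simpa using hB (f x) ⟨toWeakSpace ℝ E x, ⟨x, x.2, rfl⟩, by simp⟩
  obtain ⟨B, hB⟩ := banach_steinhaus h
  refine isBounded_iff_forall_norm_le.2 ⟨B, fun x hx => ?_⟩
  have := hB ⟨x, hx⟩
  rwa [show ‖NormedSpace.inclusionInDoubleDual ℝ E x‖ = ‖x‖ from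
    (NormedSpace.inclusionInDoubleDualLi ℝ).norm_map x] at this

/-- Weak lower semicontinuity of the norm, with a bound `b n` in place of `‖x n‖`. -/
theorem norm_le_of_tendsto_toWeakSpace {ι : Type*} {l : Filter ι} [l.NeBot] {x : ι → E} {a : E}
    (h : Tendsto (fun n => toWeakSpace ℝ E (x n)) l (𝓝 (toWeakSpace ℝ E a))) {b : ι → ℝ} {r : ℝ}
    (hb : Tendsto b l (𝓝 r)) (hr : ∀ᶠ n in l, ‖x n‖ ≤ b n) : ‖a‖ ≤ r := by
  obtain ⟨f, hf, hfa⟩ := exists_dual_vector'' ℝ a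
  have h1 := tendsto_toWeakSpace_iff.1 h f
  rw [hfa] at h1
  refine le_of_tendsto_of_tendsto h1 hb (hr.mono fun n hn => ?_)
  calc f (x n) ≤ ‖f (x n)‖ := Real.le_norm_self _
    _ ≤ ‖f‖ * ‖x n‖ := f.le_opNorm _
    _ ≤ 1 * ‖x n‖ := by gcongr
    _ ≤ b n := by rwa [one_mul]

theorem weaklyNull_map_sub {F : Type*} [NormedAddCommGroup F] [NormedSpace ℝ F]
    (L : E →L[ℝ] F) {w : ℕ → E} {a : E}
    (h : Tendsto (fun n => toWeakSpace ℝ E (w n)) atTop (𝓝 (toWeakSpace ℝ E a))) :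
    WeaklyNull (fun n => L (w n) - L a) := by
  refine tendsto_toWeakSpace_iff.2 fun f => ?_
  have h1 := (tendsto_toWeakSpace_iff.1 h (f.comp L)).sub_const (f (L a))
  simpa using h1

theorem norm_map_sub_le_of_tendsto_toWeakSpace {F : Type*} [NormedAddCommGroup F]
    [NormedSpace ℝ F] {l : Filter ℕ} [l.NeBot] {w : ℕ → E} {a : E}
    (hwa : Tendsto (fun n => toWeakSpace ℝ E (w n)) l (𝓝 (toWeakSpace ℝ E a))) (L : E →L[ℝ] F)
    {ρ : ℕ → ℝ} (hρ : ∀ m, Tendsto (fun n => ‖L (w n) - L (w m)‖) l (𝓝 (ρ m))) (m : ℕ) :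
    ‖L (w m) - L a‖ ≤ ρ m := by
  have h1 : Tendsto (fun n => toWeakSpace ℝ F (L (w n) - L (w m))) l
      (𝓝 (toWeakSpace ℝ F (L a - L (w m)))) := by
    refine tendsto_toWeakSpace_iff.2 fun f => ?_
    have h2 := (tendsto_toWeakSpace_iff.1 hwa (f.comp L)).sub_const (f (L (w m)))
    simpa using h2
  rw [norm_sub_rev]
  exact norm_le_of_tendsto_toWeakSpace h1 (hρ m) (Eventually.of_forall fun n => le_rfl)

end WeakTopology

/-! ### Subsequences and limits along ultrafilters -/

/-- A subsequence chosen one term at a time, each new term from a large set that depends on the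
previous index only. As the indices below a given bound are finitely many, such a set can take
account of all the earlier terms. -/
theorem exists_strictMono_forall_succ {l : Filter ℕ} [l.NeBot] (hl : l ≤ atTop)
    {A : ℕ → ℕ → Prop} (hA : ∀ m, ∀ᶠ n in l, A m n) :
    ∃ f : ℕ → ℕ, StrictMono f ∧ ∀ j, A (f j) (f (j + 1)) := by
  have h : ∀ m, ∃ n, m < n ∧ A m n := fun m =>
    (((eventually_gt_atTop m).filter_mono hl).and (hA m)).exists
  choose g hg hgA using h
  let f : ℕ → ℕ := fun j => g^[j] 0
  have hf : ∀ j, f (j + 1) = g (f j) := fun j => Function.iterate_succ_apply' g j 0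
  refine ⟨f, strictMono_nat_of_lt_succ fun j => ?_, fun j => ?_⟩
  · rw [hf]; exact hg _
  · rw [hf]; exact hgA _

theorem exists_tendsto_ultrafilter {ι : Type*} (U : Ultrafilter ι) {u : ι → ℝ} {a b : ℝ}
    (h : ∀ n, u n ∈ Set.Icc a b) : ∃ c ∈ Set.Icc a b, Tendsto u U (𝓝 c) := by
  have := (isCompact_Icc (a := a) (b := b)).ultrafilter_le_nhds' (U.map u)
    (Filter.mem_map.2 (univ_mem' h))
  exact this

/-! ### Weak sequential compactness -/

section EberleinSmulian

variable {E : Type*} [NormedAddCommGroup E] [NormedSpace ℝ E]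

/-- Norming functionals of the points of a dense sequence separate the points of a separable
set from `0`. -/
theorem exists_seq_dual_separating {S : Set E} (hS : TopologicalSpace.IsSeparable S) :
    ∃ f : ℕ → StrongDual ℝ E, ∀ z ∈ S, (∀ k, f k z = 0) → z = 0 := by
  rcases S.eq_empty_or_nonempty with rfl | hne
  · exact ⟨fun _ => 0, by simp⟩
  obtain ⟨c, hc, hSc⟩ := hS
  have hcne : c.Nonempty := by
    by_contra h
    rw [Set.not_nonempty_iff_eq_empty] at h
    subst h
    simp only [closure_empty, Set.subset_empty_iff] at hSc
    exact hne.ne_empty hSc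
  obtain ⟨e, rfl⟩ := hc.exists_eq_range hcne
  choose f hf hfe using fun k => exists_dual_vector'' ℝ (e k)
  refine ⟨f, fun z hz h => ?_⟩
  by_contra hz0
  have hpos : 0 < ‖z‖ / 2 := by positivity
  obtain ⟨_, ⟨k, rfl⟩, hk⟩ := Metric.mem_closure_iff.1 (hSc hz) _ hpos
  rw [dist_eq_norm] at hk
  have h1 : ‖e k‖ ≤ ‖z - e k‖ := by
    have h2 : f k (e k - z) = ‖e k‖ := by rw [map_sub, h k, sub_zero]; exact hfe k
    calc ‖e k‖ = f k (e k - z) := h2.symm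
      _ ≤ ‖f k (e k - z)‖ := Real.le_norm_self _
      _ ≤ ‖f k‖ * ‖e k - z‖ := (f k).le_opNorm _
      _ ≤ 1 * ‖e k - z‖ := by gcongr; exact hf k
      _ = ‖z - e k‖ := by rw [one_mul, norm_sub_rev]
  have h3 : ‖z‖ ≤ ‖z - e k‖ + ‖e k‖ := by simpa using norm_add_le (z - e k) (e k)
  linarith

/-- Eberlein--Šmulian: a weakly compact set is weakly sequentially compact. The weak limit `a`
along an ultrafilter is also the limit of a subsequence along which countably many functionals,
separating the points of the closed span of the sequence, converge to their values at `a`. -/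
theorem exists_subseq_tendsto_toWeakSpace {C : Set E} (hC : IsCompact (toWeakSpace ℝ E '' C))
    {x : ℕ → E} (hx : ∀ n, x n ∈ C) :
    ∃ φ : ℕ → ℕ, StrictMono φ ∧ ∃ a ∈ C,
      Tendsto (fun n => toWeakSpace ℝ E (x (φ n))) atTop (𝓝 (toWeakSpace ℝ E a)) := by
  obtain ⟨_, ⟨a, ha, rfl⟩, hlim⟩ := hC.ultrafilter_le_nhds'
    ((hyperfilter ℕ).map fun n => toWeakSpace ℝ E (x n))
    (Filter.mem_map.2 (univ_mem' fun n => ⟨x n, hx n, rfl⟩))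
  have hlim' : Tendsto (fun n => toWeakSpace ℝ E (x n)) (hyperfilter ℕ : Filter ℕ)
    (𝓝 (toWeakSpace ℝ E a)) := hlim
  let V : Submodule ℝ E := (Submodule.span ℝ (Set.range x)).topologicalClosure
  have hVcl : IsClosed (V : Set E) := Submodule.isClosed_topologicalClosure _
  have hxV : ∀ n, x n ∈ V := fun n =>
    Submodule.le_topologicalClosure _ (Submodule.subset_span ⟨n, rfl⟩)
  have hVsep : TopologicalSpace.IsSeparable (V : Set E) := by
    change TopologicalSpace.IsSeparable (closure (Submodule.span ℝ (Set.range x) : Set E))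
    exact ((Set.countable_range x).isSeparable.span (R := ℝ)).closure
  have hVweak := isClosed_toWeakSpace_image V.convex hVcl
  have hmemV : ∀ (l : Filter ℕ) (ψ : ℕ → ℕ) (z : E),
      MapClusterPt (toWeakSpace ℝ E z) l (fun n => toWeakSpace ℝ E (x (ψ n))) → z ∈ V := by
    intro l ψ z hz
    obtain ⟨z', hz', h⟩ := hVweak.mem_of_mapClusterPt hz
      (Eventually.of_forall fun n => ⟨x (ψ n), hxV _, rfl⟩)
    rwa [(toWeakSpace ℝ E).injective h] at hz'
  have haV : a ∈ V := hmemV _ id a hlim'.mapClusterPt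
  obtain ⟨f, hf⟩ := exists_seq_dual_separating hVsep
  have hA : ∀ m : ℕ, ∀ᶠ n in (hyperfilter ℕ : Filter ℕ),
      ∀ k ∈ Set.Iic m, |f k (x n) - f k a| < 1 / ((m : ℝ) + 1) := by
    intro m
    refine (Filter.eventually_all_finite (Set.finite_Iic m)).2 fun k _ => ?_
    have h := tendsto_toWeakSpace_iff.1 hlim' (f k)
    exact (Metric.tendsto_nhds.1 h) _ (by positivity)
  obtain ⟨φ, hφ, hφA⟩ := exists_strictMono_forall_succ Nat.hyperfilter_le_atTop hA
  have hconv : ∀ k, Tendsto (fun j => f k (x (φ j))) atTop (𝓝 (f k a)) := by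
    intro k
    rw [← tendsto_add_atTop_iff_nat 1]
    refine tendsto_iff_dist_tendsto_zero.2 (squeeze_zero' (Eventually.of_forall fun _ =>
      dist_nonneg) ?_ tendsto_one_div_add_atTop_nhds_zero_nat)
    filter_upwards [eventually_ge_atTop k] with j hj
    have h1 : j ≤ φ j := hφ.id_le j
    refine (hφA j k (hj.trans h1)).le.trans ?_
    gcongr
  refine ⟨φ, hφ, a, ha, hC.tendsto_nhds_of_unique_mapClusterPt
    (Eventually.of_forall fun n => ⟨_, hx _, rfl⟩) ?_⟩
  rintro _ ⟨z, -, rfl⟩ hz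
  have hzV : z - a ∈ V := V.sub_mem (hmemV _ φ z hz) haV
  have h0 : z - a = 0 := by
    refine hf _ hzV fun k => ?_
    have h1 := hz.continuousAt_comp (continuous_eval_weakSpace (f k)).continuousAt
    have h2 : ClusterPt (f k z) (𝓝 (f k a)) := ClusterPt.mono h1 (hconv k)
    rw [map_sub, sub_eq_zero]
    exact @eq_of_nhds_neBot _ _ _ _ _ h2
  rw [sub_eq_zero.1 h0]

end EberleinSmulian

/-! ### Minimal invariant sets -/

section MinimalSets

variable {E : Type*} [NormedAddCommGroup E]

/-- `T` is a nonexpansive self-mapping of `C`; its values outside `C` play no role. -/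
structure NonexpansiveSelfMap (T : E → E) (C : Set E) : Prop where
  mapsTo : Set.MapsTo T C C
  norm_le : ∀ x ∈ C, ∀ y ∈ C, ‖T x - T y‖ ≤ ‖x - y‖

theorem NonexpansiveSelfMap.continuousOn {T : E → E} {C : Set E}
    (hT : NonexpansiveSelfMap T C) : ContinuousOn T C := by
  refine LipschitzOnWith.continuousOn (K := 1) (LipschitzOnWith.of_dist_le_mul fun x hx y hy => ?_)
  simpa [dist_eq_norm] using hT.norm_le x hx y hy

theorem NonexpansiveSelfMap.mono {T : E → E} {C D : Set E} (hT : NonexpansiveSelfMap T C)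
    (hDC : D ⊆ C) (hD : Set.MapsTo T D D) : NonexpansiveSelfMap T D :=
  ⟨hD, fun x hx y hy => hT.norm_le x (hDC hx) y (hDC hy)⟩

variable [NormedSpace ℝ E]

/-- `M` is minimal among the nonempty closed convex sets that `T` maps into themselves. -/
structure IsMinimalInvariant (T : E → E) (M : Set E) : Prop where
  nonempty : M.Nonempty
  convex : Convex ℝ M
  isClosed : IsClosed M
  mapsTo : Set.MapsTo T M M
  eq_of_subset : ∀ D ⊆ M, D.Nonempty → Convex ℝ D → IsClosed D → Set.MapsTo T D D → D = M

theorem exists_isMinimalInvariant {T : E → E} {C : Set E} (hne : C.Nonempty) (hconv : Convex ℝ C)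
    (hC : IsCompact (toWeakSpace ℝ E '' C)) (hT : Set.MapsTo T C C) :
    ∃ M ⊆ C, IsMinimalInvariant T M := by
  let S : Set (Set E) :=
    {D | D ⊆ C ∧ D.Nonempty ∧ Convex ℝ D ∧ IsClosed D ∧ Set.MapsTo T D D}
  have hCS : C ∈ S := ⟨subset_rfl, hne, hconv, isClosed_of_isCompact_toWeakSpace hC, hT⟩
  obtain ⟨M, hMC, hM⟩ := zorn_superset_nonempty S (fun c hcS hc hcne => by
    refine ⟨⋂₀ c, ⟨?_, ?_, ?_, ?_, ?_⟩, fun s hs => Set.sInter_subset_of_mem hs⟩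
    · obtain ⟨D, hD⟩ := hcne
      exact (Set.sInter_subset_of_mem hD).trans (hcS hD).1
    · have hcne' : Nonempty c := hcne.to_subtype
      have h := IsCompact.nonempty_iInter_of_directed_nonempty_isCompact_isClosed
        (fun D : c => toWeakSpace ℝ E '' (D : Set E)) (fun D₁ D₂ => by
          rcases hc.total D₁.2 D₂.2 with h | h
          · exact ⟨D₁, subset_rfl, Set.image_mono h⟩
          · exact ⟨D₂, Set.image_mono h, subset_rfl⟩)
        (fun D => (hcS D.2).2.1.image _)
        (fun D => isCompact_toWeakSpace_of_subset hC (hcS D.2).1 (hcS D.2).2.2.1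
          (hcS D.2).2.2.2.1)
        (fun D => isClosed_toWeakSpace_image (hcS D.2).2.2.1 (hcS D.2).2.2.2.1)
      obtain ⟨u, hu⟩ := h
      refine ⟨(toWeakSpace ℝ E).symm u, fun D hD => ?_⟩
      obtain ⟨v, hv, rfl⟩ := Set.mem_iInter.1 hu ⟨D, hD⟩
      simpa using hv
    · exact convex_sInter fun D hD => (hcS hD).2.2.1
    · exact isClosed_sInter fun D hD => (hcS hD).2.2.2.1
    · exact fun x hx D hD => (hcS hD).2.2.2.2 (hx D hD)) C hCS
  obtain ⟨h1, h2, h3, h4, h5⟩ := hM.prop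
  refine ⟨M, hMC, h2, h3, h4, h5, fun D hDM hD1 hD2 hD3 hD4 => ?_⟩
  exact hM.eq_of_subset ⟨hDM.trans h1, hD1, hD2, hD3, hD4⟩ hDM

/-- Every nonempty convex invariant subset of a minimal set is dense in it. -/
theorem IsMinimalInvariant.subset_closure {T : E → E} {M D : Set E} (hM : IsMinimalInvariant T M)
    (hT : NonexpansiveSelfMap T M) (hDM : D ⊆ M) (hD : D.Nonempty) (hconv : Convex ℝ D)
    (hDT : Set.MapsTo T D D) : M ⊆ closure D := by
  have hcl : closure D ⊆ M := closure_minimal hDM hM.isClosed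
  exact (hM.eq_of_subset _ hcl hD.closure hconv.closure isClosed_closure
    (hDT.closure_of_continuousOn (hT.continuousOn.mono hcl))).ge

/-- Approximate fixed points are the fixed points of the contractions
`x ↦ (1 - t) • T x + t • x₀`. -/
theorem NonexpansiveSelfMap.exists_norm_sub_le [CompleteSpace E] {T : E → E} {C : Set E}
    (hT : NonexpansiveSelfMap T C) (hne : C.Nonempty) (hconv : Convex ℝ C) (hcl : IsClosed C)
    (hb : Bornology.IsBounded C) {ε : ℝ} (hε : 0 < ε) : ∃ x ∈ C, ‖T x - x‖ ≤ ε := by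
  obtain ⟨x₀, hx₀⟩ := hne
  obtain ⟨B, hB0, hB⟩ := hb.exists_pos_norm_le
  obtain ⟨t, ht0, ht1, htε⟩ : ∃ t : ℝ, 0 < t ∧ t < 1 ∧ t * (2 * B) ≤ ε := by
    refine ⟨min (1 / 2) (ε / (2 * B)), by positivity,
      (min_le_left _ _).trans_lt (by norm_num), ?_⟩
    calc min (1 / 2) (ε / (2 * B)) * (2 * B) ≤ ε / (2 * B) * (2 * B) := by
          gcongr; exact min_le_right _ _
      _ = ε := by field_simp
  let S : E → E := fun x => (1 - t) • T x + t • x₀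
  have hS : Set.MapsTo S C C := fun x hx =>
    hconv (hT.mapsTo hx) hx₀ (by linarith) ht0.le (by ring)
  have hcontr : ContractingWith (Real.toNNReal (1 - t)) (hS.restrict S C C) := by
    refine ⟨by rw [Real.toNNReal_lt_one]; linarith, LipschitzWith.of_dist_le_mul ?_⟩
    rintro ⟨x, hx⟩ ⟨y, hy⟩
    rw [Real.coe_toNNReal _ (by linarith)]
    change dist (S x) (S y) ≤ (1 - t) * dist x y
    have h1 : S x - S y = (1 - t) • (T x - T y) := by simp only [S]; module
    rw [dist_eq_norm, dist_eq_norm, h1, norm_smul, Real.norm_of_nonneg (by linarith)]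
    exact mul_le_mul_of_nonneg_left (hT.norm_le x hx y hy) (by linarith)
  obtain ⟨x, hx, hfix, -⟩ := hcontr.exists_fixedPoint' hcl.isComplete hS hx₀ (edist_ne_top _ _)
  refine ⟨x, hx, ?_⟩
  have h2 : T x - x = t • (T x - x₀) := by
    have h3 : (1 - t) • T x + t • x₀ = x := hfix
    nth_rewrite 2 [← h3]
    module
  rw [h2, norm_smul, Real.norm_of_nonneg ht0.le]
  refine le_trans ?_ htε
  gcongr
  linarith [norm_sub_le (T x) x₀, hB _ (hT.mapsTo hx), hB _ hx₀]

/-- A continuous convex function that does not increase along `T` is constant on a minimal set,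
because its sublevel sets are invariant. -/
theorem IsMinimalInvariant.eq_of_convexOn {T : E → E} {M : Set E} (hM : IsMinimalInvariant T M)
    {p : E → ℝ} (hp : ConvexOn ℝ M p) (hpc : Continuous p) (hpT : ∀ x ∈ M, p (T x) ≤ p x)
    {x y : E} (hx : x ∈ M) (hy : y ∈ M) : p x = p y := by
  have key : ∀ x ∈ M, ∀ y ∈ M, p y ≤ p x := by
    intro x hx y hy
    have h := hM.eq_of_subset {z ∈ M | p z ≤ p x} (Set.sep_subset _ _) ⟨x, hx, le_rfl⟩
      (hp.convex_le _) (hM.isClosed.inter (isClosed_le hpc continuous_const))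
      (fun z hz => ⟨hM.mapsTo hz.1, (hpT z hz.1).trans hz.2⟩)
    rw [← h] at hy
    exact hy.2
  exact le_antisymm (key y hy x hx) (key x hx y hy)

/-- A minimal invariant set is diametral: no ball centred in it of radius less than its diameter
contains it. -/
theorem IsMinimalInvariant.diam_le {T : E → E} {M : Set E} (hM : IsMinimalInvariant T M)
    (hT : NonexpansiveSelfMap T M) {a : E} (ha : a ∈ M) {r : ℝ} (hr : ∀ x ∈ M, ‖a - x‖ ≤ r) :
    Metric.diam M ≤ r := by
  have hr0 : 0 ≤ r := (norm_nonneg _).trans (hr a ha)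
  -- The centres `z` of the balls of radius `r` that contain `M` form an invariant set, because
  -- the part of `M` in the ball of radius `r` about `T z` contains the image of `M`.
  have h : {z ∈ M | ∀ x ∈ M, ‖z - x‖ ≤ r} = M := by
    have hball : ∀ x : E, {z : E | ‖z - x‖ ≤ r} = Metric.closedBall x r := fun x => by
      ext z; simp [dist_eq_norm]
    have hset : {z ∈ M | ∀ x ∈ M, ‖z - x‖ ≤ r} = M ∩ ⋂ x ∈ M, Metric.closedBall x r := by
      ext z; simp [dist_eq_norm]
    refine hM.eq_of_subset _ (Set.sep_subset _ _) ⟨a, ha, hr⟩ ?_ ?_ ?_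
    · rw [hset]
      exact hM.convex.inter (convex_iInter₂ fun x _ => convex_closedBall x r)
    · rw [hset]
      exact hM.isClosed.inter (isClosed_biInter fun x _ => Metric.isClosed_closedBall)
    · rintro z ⟨hz, hzr⟩
      refine ⟨hM.mapsTo hz, ?_⟩
      have h' := hM.eq_of_subset (M ∩ Metric.closedBall (T z) r) Set.inter_subset_left
        ⟨T z, hM.mapsTo hz, Metric.mem_closedBall_self hr0⟩
        (hM.convex.inter (convex_closedBall _ _)) (hM.isClosed.inter Metric.isClosed_closedBall)
        (fun x hx => ⟨hM.mapsTo hx.1, by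
          rw [Metric.mem_closedBall, dist_eq_norm, norm_sub_rev]
          exact (hT.norm_le z hz x hx.1).trans (hzr x hx.1)⟩)
      intro x hx
      rw [← h'] at hx
      have := hx.2
      rwa [Metric.mem_closedBall, dist_eq_norm, norm_sub_rev] at this
  refine Metric.diam_le_of_forall_dist_le hr0 fun x hx y hy => ?_
  rw [← h] at hx
  rw [dist_eq_norm]
  exact hx.2 y hy

/-- Goebel--Karlovitz: the distances from a weakly convergent approximate fixed point sequence in
a minimal set to any point of the set tend to the diameter of the set. -/
theorem IsMinimalInvariant.tendsto_norm_sub {T : E → E} {M : Set E} (hM : IsMinimalInvariant T M)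
    (hT : NonexpansiveSelfMap T M) (hb : Bornology.IsBounded M) (U : Ultrafilter ℕ) {w : ℕ → E}
    (hw : ∀ n, w n ∈ M) (hwT : Tendsto (fun n => ‖T (w n) - w n‖) U (𝓝 0)) {a : E} (ha : a ∈ M)
    (hwa : Tendsto (fun n => toWeakSpace ℝ E (w n)) U (𝓝 (toWeakSpace ℝ E a))) {z : E}
    (hz : z ∈ M) : Tendsto (fun n => ‖w n - z‖) U (𝓝 (Metric.diam M)) := by
  obtain ⟨B, hB⟩ := hb.exists_norm_le
  have hlim : ∀ x : E, ∃ c, Tendsto (fun n => ‖w n - x‖) U (𝓝 c) := by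
    intro x
    obtain ⟨c, -, hc⟩ := exists_tendsto_ultrafilter U (u := fun n => ‖w n - x‖) (a := 0)
      (b := B + ‖x‖) fun n => ⟨norm_nonneg _, (norm_sub_le _ _).trans (by
        have := hB _ (hw n); linarith)⟩
    exact ⟨c, hc⟩
  choose p hp using hlim
  have hpc : Continuous p := by
    refine (LipschitzWith.of_dist_le_mul (K := 1) fun x y => ?_).continuous
    have h1 : Tendsto (fun n => |‖w n - x‖ - ‖w n - y‖|) U (𝓝 |p x - p y|) :=
      ((hp x).sub (hp y)).abs
    rw [NNReal.coe_one, one_mul, Real.dist_eq]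
    refine le_of_tendsto h1 (Eventually.of_forall fun n => ?_)
    refine (abs_norm_sub_norm_le _ _).trans ?_
    rw [dist_eq_norm, sub_sub_sub_cancel_left, norm_sub_rev]
  have hpconv : ConvexOn ℝ M p := by
    refine ⟨hM.convex, fun x _ y _ s t hs ht hst => ?_⟩
    refine le_of_tendsto_of_tendsto' (hp _) (((hp x).const_mul s).add ((hp y).const_mul t))
      fun n => ?_
    have h1 : w n - (s • x + t • y) = s • (w n - x) + t • (w n - y) := by
      have : w n = (s + t) • w n := by rw [hst, one_smul]
      nth_rewrite 1 [this]
      module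
    rw [h1]
    refine (norm_add_le _ _).trans ?_
    rw [norm_smul, norm_smul, Real.norm_of_nonneg hs, Real.norm_of_nonneg ht]
  have hpT : ∀ x ∈ M, p (T x) ≤ p x := by
    intro x hx
    have h1 := hwT.add (hp x)
    rw [zero_add] at h1
    refine le_of_tendsto_of_tendsto' (hp _) h1 fun n => ?_
    calc ‖w n - T x‖ ≤ ‖w n - T (w n)‖ + ‖T (w n) - T x‖ := norm_sub_le_norm_sub_add_norm_sub _ _ _
      _ ≤ ‖T (w n) - w n‖ + ‖w n - x‖ := by
        rw [norm_sub_rev (w n)]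
        gcongr
        exact hT.norm_le _ (hw n) _ hx
  have hconst : ∀ x ∈ M, p x = p z := fun x hx => hM.eq_of_convexOn hpconv hpc hpT hx hz
  have hle : Metric.diam M ≤ p z := by
    refine hM.diam_le hT ha fun x hx => ?_
    have h1 : Tendsto (fun n => toWeakSpace ℝ E (w n - x)) U (𝓝 (toWeakSpace ℝ E (a - x))) := by
      rw [tendsto_toWeakSpace_iff] at hwa ⊢
      intro f
      simpa using (hwa f).sub_const (f x)
    exact norm_le_of_tendsto_toWeakSpace h1 (hconst x hx ▸ hp x)
      (Eventually.of_forall fun n => le_rfl)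
  have hge : p z ≤ Metric.diam M := by
    refine le_of_tendsto (hp z) (Eventually.of_forall fun n => ?_)
    rw [← dist_eq_norm]
    exact Metric.dist_le_diam_of_mem hb (hw n) hz
  rw [le_antisymm hle hge]
  exact hp z

end MinimalSets

/-! ### Sparse means and mutual distances of weakly null sequences -/

section Sequences

variable {E : Type*} [NormedAddCommGroup E]

/-- `‖s + v n₁ + ⋯ + v nₘ‖ ≤ b` for `l`-almost all `n₁`, for `l`-almost all `n₂`, and so on, where
the set of admissible `nᵢ` may depend on `n₁, …, nᵢ₋₁`. -/
def IteratedSumLE (l : Filter ℕ) (v : ℕ → E) (b : ℝ) : ℕ → E → Prop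
  | 0, s => ‖s‖ ≤ b
  | m + 1, s => ∀ᶠ n in l, IteratedSumLE l v b m (s + v n)

variable [NormedSpace ℝ E]

theorem WeaklyNull.comp_strictMono {v : ℕ → E} (hv : WeaklyNull v) {φ : ℕ → ℕ}
    (hφ : StrictMono φ) : WeaklyNull (fun n => v (φ n)) :=
  Tendsto.comp (f := φ) (g := fun n => toWeakSpace ℝ E (v n)) hv hφ.tendsto_atTop

/-- The weak Banach--Saks property yields arithmetic means of a fixed length that are small for
all sufficiently sparse choices of the terms. Otherwise, since along an ultrafilter the failure of
a property almost everywhere is its negation almost everywhere, there is a subsequence in which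
any `K` terms from the `K`-th on have a large mean; a further subsequence with Cesàro means
tending to `0` contradicts this, as its block from `K` to `2 * K` has a small mean. -/
theorem HasWeakBanachSaks.exists_iteratedSumLE (hE : HasWeakBanachSaks E) {v : ℕ → E}
    (hv : WeaklyNull v) {U : Ultrafilter ℕ} (hU : (U : Filter ℕ) ≤ atTop) {ε : ℝ} (hε : 0 < ε) :
    ∃ K : ℕ, 1 ≤ K ∧ IteratedSumLE U v (ε * K) K 0 := by
  by_contra! hbad
  have hA : ∀ m : ℕ, ∀ᶠ n in (U : Filter ℕ), ∀ K ∈ Finset.range (m + 2),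
      ∀ r ∈ Finset.range (m + 2), ∀ S ∈ (Finset.range (m + 1)).powerset,
        ¬ IteratedSumLE U v (ε * K) (r + 1) (∑ i ∈ S, v i) →
          ¬ IteratedSumLE U v (ε * K) r (∑ i ∈ S, v i + v n) := by
    intro m
    rw [Filter.eventually_all_finset]
    intro K _
    rw [Filter.eventually_all_finset]
    intro r _
    rw [Filter.eventually_all_finset]
    intro S _
    rw [Filter.eventually_imp_distrib_left]
    exact fun h => Ultrafilter.eventually_not.2 h
  obtain ⟨f, hf, hfA⟩ := exists_strictMono_forall_succ hU hA
  obtain ⟨φ, hφ, hmean⟩ := hE _ (hv.comp_strictMono hf)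
  have key : ∀ K : ℕ, 1 ≤ K → ∀ r ≤ K,
      ¬ IteratedSumLE U v (ε * K) (K - r) (∑ i ∈ Finset.Ico K (K + r), v (f (φ i))) := by
    intro K hK r
    induction r with
    | zero => intro _; simpa using hbad K hK
    | succ r ih =>
      intro hr
      have h1 : K + r ≤ φ (K + r) := hφ.id_le _
      obtain ⟨j, hj⟩ : ∃ j, φ (K + r) = j + 1 := ⟨φ (K + r) - 1, by omega⟩
      have h2 : j ≤ f j := hf.id_le j
      have h3 := hfA j K (Finset.mem_range.2 (by omega)) (K - (r + 1))
        (Finset.mem_range.2 (by omega)) ((Finset.Ico K (K + r)).image (f ∘ φ))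
        (by
          rw [Finset.mem_powerset]
          intro n hn
          obtain ⟨i, hi, rfl⟩ := Finset.mem_image.1 hn
          have h4 : φ i < φ (K + r) := hφ (Finset.mem_Ico.1 hi).2
          have h5 : f (φ i) ≤ f j := hf.monotone (by omega)
          exact Finset.mem_range.2 (Nat.lt_succ_of_le h5))
      rw [Finset.sum_image ((hf.comp hφ).injective.injOn (s := Finset.Ico K (K + r))),
        show K - (r + 1) + 1 = K - r by omega] at h3
      have h6 := h3 (ih (by omega))
      rw [← hj] at h6
      rwa [← add_assoc, Finset.sum_Ico_succ_top (by omega)]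
  obtain ⟨N, hN⟩ := eventually_atTop.1 (hmean.eventually (gt_mem_nhds (by positivity : 0 < ε / 3)))
  have hsum : ∀ n, N ≤ n → 1 ≤ n → ‖∑ k ∈ Finset.range n, v (f (φ k))‖ ≤ n * (ε / 3) := by
    intro n hn hn1
    have hn0 : (0 : ℝ) < n := by exact_mod_cast hn1
    have h := (hN n hn).le
    rw [norm_smul, Real.norm_of_nonneg (by positivity), one_div, ← div_eq_inv_mul,
      div_le_iff₀ hn0] at h
    linarith
  refine key (N + 1) (by omega) (N + 1) le_rfl ?_
  rw [Nat.sub_self, Finset.sum_Ico_eq_sub _ (by omega)]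
  change ‖_‖ ≤ _
  refine (norm_sub_le _ _).trans ?_
  have h1 := hsum (N + 1) (by omega) (by omega)
  have h2 := hsum (N + 1 + (N + 1)) (by omega) (by omega)
  rw [Nat.cast_add (N + 1)] at h2
  linarith

/-- In a space with property asymptotic (P), if the mutual distances and the norms of a weakly
null sequence have the same limit `a` along an ultrafilter, then `a = 0`: otherwise there is a
subsequence of asymptotic diameter `a` whose norms tend to `a`. -/
theorem HasAsymptoticP.eq_zero (hE : HasAsymptoticP E) {y : ℕ → E} (hy : WeaklyNull y)
    {U : Ultrafilter ℕ} (hU : (U : Filter ℕ) ≤ atTop) {L : ℕ → ℝ} {a : ℝ}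
    (hL : ∀ m, Tendsto (fun n => ‖y n - y m‖) U (𝓝 (L m))) (hLa : Tendsto L U (𝓝 a))
    (hya : Tendsto (fun n => ‖y n‖) U (𝓝 a)) : a = 0 := by
  by_contra hne
  have ha : 0 < a := lt_of_le_of_ne (ge_of_tendsto' hya fun n => norm_nonneg _) (Ne.symm hne)
  have hA : ∀ m : ℕ, ∀ᶠ n in (U : Filter ℕ),
      (∀ k ∈ Finset.range (m + 1), |‖y n - y k‖ - L k| < 1 / ((m : ℝ) + 1)) ∧
        |L n - a| < 1 / ((m : ℝ) + 1) ∧ |‖y n‖ - a| < 1 / ((m : ℝ) + 1) := by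
    intro m
    have hpos : 0 < 1 / ((m : ℝ) + 1) := by positivity
    refine ((Filter.eventually_all_finset _).2 fun k _ => ?_).and (.and ?_ ?_)
    · exact Metric.tendsto_nhds.1 (hL k) _ hpos
    · exact Metric.tendsto_nhds.1 hLa _ hpos
    · exact Metric.tendsto_nhds.1 hya _ hpos
  obtain ⟨f, hf, hfA⟩ := exists_strictMono_forall_succ hU hA
  let e : ℕ → ℝ := fun n => 1 / ((n : ℝ) + 1)
  have he : Tendsto e atTop (𝓝 0) := tendsto_one_div_add_atTop_nhds_zero_nat
  have hmono : ∀ {i j : ℕ}, i ≤ j → e j ≤ e i := fun {i j} h => by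
    simp only [e]; gcongr
  have hfe : ∀ {i j : ℕ}, i ≤ j → e (f j) ≤ e i := fun {i j} h => hmono (h.trans (hf.id_le j))
  let x : ℕ → E := fun j => y (f (j + 1))
  have hx : WeaklyNull x := hy.comp_strictMono (hf.comp (strictMono_id.add_const 1))
  have hdist : ∀ i j, i < j → |‖x j - x i‖ - a| ≤ 2 * e i := by
    intro i j hij
    have h1 := ((hfA j).1 (f (i + 1))
      (Finset.mem_range.2 (Nat.lt_succ_of_le (hf.monotone hij)))).le
    have h2 := (hfA i).2.1.le
    have h3 := abs_sub_le ‖x j - x i‖ (L (f (i + 1))) a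
    linarith [hfe hij.le, hfe (le_refl i)]
  have hnorm : Tendsto (fun n => ‖x n‖) atTop (𝓝 a) := by
    refine tendsto_iff_dist_tendsto_zero.2 (squeeze_zero (fun _ => dist_nonneg) (fun n => ?_) he)
    exact (hfA n).2.2.le.trans (hfe le_rfl)
  have hpair : ∀ n, ∀ u ∈ x '' Set.Ici n, ∀ v ∈ x '' Set.Ici n, dist u v ≤ a + 2 * e n := by
    rintro n _ ⟨i, hi, rfl⟩ _ ⟨j, hj, rfl⟩
    rw [dist_eq_norm]
    rcases lt_trichotomy i j with h | rfl | h
    · rw [norm_sub_rev]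
      linarith [(abs_le.1 (hdist i j h)).2, hmono (Set.mem_Ici.1 hi)]
    · rw [sub_self, norm_zero]; positivity
    · linarith [(abs_le.1 (hdist j i h)).2, hmono (Set.mem_Ici.1 hj)]
  have hdiam : IsAsymptoticDiam x a := by
    have h2e : Tendsto (fun n => 2 * e n) atTop (𝓝 0) := by simpa using he.const_mul 2
    have hlow : Tendsto (fun n => a - 2 * e n) atTop (𝓝 a) := by simpa using h2e.const_sub a
    have hupp : Tendsto (fun n => a + 2 * e n) atTop (𝓝 a) := by simpa using h2e.const_add a
    refine tendsto_of_tendsto_of_tendsto_of_le_of_le hlow hupp (fun n => ?_) (fun n => ?_)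
    · have h1 := (abs_le.1 (hdist n (n + 1) n.lt_succ_self)).1
      have h2 : dist (x (n + 1)) (x n) ≤ Metric.diam (x '' Set.Ici n) :=
        Metric.dist_le_diam_of_mem (Metric.isBounded_iff.2 ⟨_, fun u hu v hv => hpair n u hu v hv⟩)
          ⟨n + 1, Set.mem_Ici.2 n.le_succ, rfl⟩ ⟨n, Set.mem_Ici.2 le_rfl, rfl⟩
      rw [dist_eq_norm] at h2
      linarith
    · exact Metric.diam_le_of_forall_dist_le (by positivity) (hpair n)
  have := hE x hx a hdiam ha
  rw [hnorm.liminf_eq] at this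
  exact lt_irrefl _ this

end Sequences

/-! ### Metric averaging processes -/

section Reachable

variable {E : Type*} [NormedAddCommGroup E]

/-- `m` further approximate averaging steps lead from `a` to within `ε` of `z`. Step number
`j + 1` replaces `a ∈ M` by some `a' ∈ M` about as far from `a` and from `w n` as the average
`(j • a + w n) / (j + 1)` would be if `‖w n - a‖ = d`; here `n` is `l`-almost arbitrary, and `δ` is
the tolerance in all the estimates. Only distances enter the definition, and so nonexpansive
mappings preserve the relation, up to the tolerance. -/
def Reachable (l : Filter ℕ) (M : Set E) (w : ℕ → E) (d ε δ : ℝ) : ℕ → ℕ → E → E → Prop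
  | 0, _, a, z => ‖a - z‖ ≤ ε + δ
  | m + 1, j, a, z => ∀ᶠ n in l, ∃ a' ∈ M, ‖a' - a‖ ≤ 1 / ((j : ℝ) + 1) * d + δ ∧
      ‖a' - w n‖ ≤ j / ((j : ℝ) + 1) * d + δ ∧ Reachable l M w d ε δ m (j + 1) a' z

variable {l : Filter ℕ} {M : Set E} {w : ℕ → E} {d ε δ : ℝ}

theorem Reachable.mono {δ' : ℝ} (hδ : δ ≤ δ') : ∀ {m j : ℕ} {a z : E},
    Reachable l M w d ε δ m j a z → Reachable l M w d ε δ' m j a z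
  | 0, _, _, _, h => by
    change ‖_‖ ≤ _ at h ⊢
    linarith
  | m + 1, j, a, z, h => by
    refine Eventually.mono h ?_
    rintro n ⟨a', ha', h1, h2, h3⟩
    exact ⟨a', ha', by linarith, by linarith, h3.mono hδ⟩

theorem Reachable.map {T : E → E} (hT : NonexpansiveSelfMap T M) (hw : ∀ n, w n ∈ M)
    (hwT : Tendsto (fun n => ‖T (w n) - w n‖) l (𝓝 0)) {δ' : ℝ} (hδ : δ < δ') :
    ∀ {m j : ℕ} {a z : E}, a ∈ M → z ∈ M →
      Reachable l M w d ε δ m j a z → Reachable l M w d ε δ' m j (T a) (T z)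
  | 0, _, a, z, ha, hz, h => by
    change ‖_‖ ≤ _ at h ⊢
    linarith [hT.norm_le a ha z hz]
  | m + 1, j, a, z, ha, hz, h => by
    filter_upwards [h, hwT.eventually (gt_mem_nhds (sub_pos.2 hδ))]
    rintro n ⟨a', ha', h1, h2, h3⟩ hn
    refine ⟨T a', hT.mapsTo ha', ?_, ?_, h3.map hT hw hwT hδ ha' hz⟩
    · linarith [hT.norm_le a' ha' a ha]
    · linarith [hT.norm_le a' ha' (w n) (hw n),
        norm_sub_le_norm_sub_add_norm_sub (T a') (T (w n)) (w n)]

variable [NormedSpace ℝ E]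

theorem norm_smul_add_smul_le {s t r : ℝ} (hs : 0 ≤ s) (ht : 0 ≤ t) (hst : s + t = 1)
    {u v : E} (hu : ‖u‖ ≤ r) (hv : ‖v‖ ≤ r) : ‖s • u + t • v‖ ≤ r := by
  have h := convex_closedBall (0 : E) r (mem_closedBall_zero_iff.2 hu)
    (mem_closedBall_zero_iff.2 hv) hs ht hst
  exact mem_closedBall_zero_iff.1 h

theorem Reachable.convex_combo (hM : Convex ℝ M) {s t : ℝ} (hs : 0 ≤ s) (ht : 0 ≤ t)
    (hst : s + t = 1) : ∀ {m j : ℕ} {a b y z : E}, Reachable l M w d ε δ m j a y →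
      Reachable l M w d ε δ m j b z →
      Reachable l M w d ε δ m j (s • a + t • b) (s • y + t • z)
  | 0, _, a, b, y, z, h, h' => by
    change ‖_‖ ≤ _ at h h' ⊢
    have h1 : s • a + t • b - (s • y + t • z) = s • (a - y) + t • (b - z) := by module
    rw [h1]
    exact norm_smul_add_smul_le hs ht hst h h'
  | m + 1, j, a, b, y, z, h, h' => by
    filter_upwards [h, h']
    rintro n ⟨a', ha', h1, h2, h3⟩ ⟨b', hb', h1', h2', h3'⟩
    refine ⟨s • a' + t • b', hM ha' hb' hs ht hst, ?_, ?_, h3.convex_combo hM hs ht hst h3'⟩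
    · have h4 : s • a' + t • b' - (s • a + t • b) = s • (a' - a) + t • (b' - b) := by module
      rw [h4]
      exact norm_smul_add_smul_le hs ht hst h1 h1'
    · have h4 : s • a' + t • b' - w n = s • (a' - w n) + t • (b' - w n) := by
        have h5 : w n = (s + t) • w n := by rw [hst, one_smul]
        nth_rewrite 1 [h5]
        module
      rw [h4]
      exact norm_smul_add_smul_le hs ht hst h2 h2'

/-- Exact averaging steps reach any point near which the arithmetic means of the `w n` lie. -/
theorem Reachable.of_iteratedSumLE (hM : Convex ℝ M) (hw : ∀ n, w n ∈ M)
    (hd : ∀ x ∈ M, ∀ y ∈ M, ‖x - y‖ ≤ d) (hδ : 0 ≤ δ) {z : E} {K : ℕ} (hK : 1 ≤ K) :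
    ∀ {m j : ℕ} {a : E}, a ∈ M → j + m = K →
      IteratedSumLE l (fun n => w n - z) (ε * K) m ((j : ℝ) • (a - z)) →
      Reachable l M w d ε δ m j a z
  | 0, j, a, _, hj, h => by
    change ‖_‖ ≤ _ at h ⊢
    obtain rfl : j = K := by omega
    have hK0 : (0 : ℝ) < j := by exact_mod_cast hK
    rw [norm_smul, Real.norm_of_nonneg hK0.le, mul_comm] at h
    linarith [le_of_mul_le_mul_right h hK0]
  | m + 1, j, a, ha, hj, h => by
    refine Eventually.mono h fun n hn => ?_
    have hj1 : (0 : ℝ) < (j : ℝ) + 1 := by positivity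
    have hst : (j : ℝ) / (j + 1) + 1 / (j + 1) = 1 := by field_simp
    have ha' := hM ha (hw n) (by positivity : 0 ≤ (j : ℝ) / (j + 1))
      (by positivity : 0 ≤ 1 / ((j : ℝ) + 1)) hst
    have hsj : (j : ℝ) / (j + 1) = 1 - 1 / (j + 1) := by linarith
    refine ⟨_, ha', ?_, ?_, Reachable.of_iteratedSumLE hM hw hd hδ hK ha' (by omega) ?_⟩
    · have h1 : ((j : ℝ) / (j + 1)) • a + (1 / ((j : ℝ) + 1)) • w n - a =
          (1 / ((j : ℝ) + 1)) • (w n - a) := by rw [hsj]; module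
      rw [h1, norm_smul, Real.norm_of_nonneg (by positivity)]
      have h2 := mul_le_mul_of_nonneg_left (hd _ (hw n) _ ha)
        (by positivity : 0 ≤ 1 / ((j : ℝ) + 1))
      linarith
    · have h1 : ((j : ℝ) / (j + 1)) • a + (1 / ((j : ℝ) + 1)) • w n - w n =
          ((j : ℝ) / (j + 1)) • (a - w n) := by rw [hsj]; module
      rw [h1, norm_smul, Real.norm_of_nonneg (by positivity)]
      have h2 := mul_le_mul_of_nonneg_left (hd _ ha _ (hw n))
        (by positivity : 0 ≤ (j : ℝ) / (j + 1))
      linarith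
    · convert hn using 1
      push_cast
      have h1 : ((j : ℝ) + 1) • (((j : ℝ) / (j + 1)) • a + (1 / ((j : ℝ) + 1)) • w n) =
          (j : ℝ) • a + w n := by
        rw [smul_add, smul_smul, smul_smul, mul_div_cancel₀ _ hj1.ne',
          mul_one_div_cancel hj1.ne', one_smul]
      rw [smul_sub, h1]
      module

/-- The points of a minimal set that are reachable, with every tolerance, from some point of it
form an invariant convex set, which is dense in the minimal set unless it is empty. -/
theorem IsMinimalInvariant.subset_closure_reachable {T : E → E} (hM : IsMinimalInvariant T M)
    (hT : NonexpansiveSelfMap T M) (hw : ∀ n, w n ∈ M)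
    (hwT : Tendsto (fun n => ‖T (w n) - w n‖) l (𝓝 0)) {K : ℕ}
    (hne : ∃ z ∈ M, ∃ a ∈ M, ∀ δ > 0, Reachable l M w d ε δ K 0 a z) :
    M ⊆ closure {z ∈ M | ∃ a ∈ M, ∀ δ > 0, Reachable l M w d ε δ K 0 a z} := by
  refine hM.subset_closure hT (Set.sep_subset _ _) hne ?_ ?_
  · rintro y ⟨hy, a, ha, hay⟩ z ⟨hz, b, hb, hbz⟩ s t hs ht hst
    exact ⟨hM.convex hy hz hs ht hst, _, hM.convex ha hb hs ht hst, fun δ hδ =>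
      (hay δ hδ).convex_combo hM.convex hs ht hst (hbz δ hδ)⟩
  · rintro z ⟨hz, a, ha, haz⟩
    exact ⟨hM.mapsTo hz, T a, hM.mapsTo ha, fun δ hδ =>
      (haz (δ / 2) (half_pos hδ)).map hT hw hwT (half_lt_self hδ) ha hz⟩

end Reachable

/-! ### Strictly monotone norms on the plane -/

namespace StrictlyMonotoneNorm

variable (Z : StrictlyMonotoneNorm)

theorem apply_one_zero_pos : 0 < Z.toSeminorm (1, 0) := by
  have h := Z.strict_mono_left 0 1 0 0 le_rfl one_pos le_rfl le_rfl
  exact (apply_nonneg Z.toSeminorm (0, 0)).trans_lt h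

theorem apply_zero_one_pos : 0 < Z.toSeminorm (0, 1) := by
  have h := Z.strict_mono_right 0 0 0 1 le_rfl le_rfl le_rfl one_pos
  exact (apply_nonneg Z.toSeminorm (0, 0)).trans_lt h

theorem apply_left {s : ℝ} (hs : 0 ≤ s) : Z.toSeminorm (s, 0) = s * Z.toSeminorm (1, 0) := by
  have h := map_smul_eq_mul Z.toSeminorm s (1, 0)
  simpa [Real.norm_of_nonneg hs] using h

theorem apply_right {t : ℝ} (ht : 0 ≤ t) : Z.toSeminorm (0, t) = t * Z.toSeminorm (0, 1) := by
  have h := map_smul_eq_mul Z.toSeminorm t (0, 1)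
  simpa [Real.norm_of_nonneg ht] using h

theorem mul_le_apply_left {s t : ℝ} (hs : 0 ≤ s) (ht : 0 ≤ t) :
    s * Z.toSeminorm (1, 0) ≤ Z.toSeminorm (s, t) := by
  rw [← Z.apply_left hs]
  exact Z.mono hs le_rfl le_rfl ht

theorem mul_le_apply_right {s t : ℝ} (hs : 0 ≤ s) (ht : 0 ≤ t) :
    t * Z.toSeminorm (0, 1) ≤ Z.toSeminorm (s, t) := by
  rw [← Z.apply_right ht]
  exact Z.mono le_rfl hs ht le_rfl

theorem apply_add_le {s s' t : ℝ} (hs' : 0 ≤ s') :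
    Z.toSeminorm (s + s', t) ≤ Z.toSeminorm (s, t) + s' * Z.toSeminorm (1, 0) := by
  have h := map_add_le_add Z.toSeminorm (s, t) (s', 0)
  rw [Z.apply_left hs'] at h
  simpa using h

theorem apply_le {s t : ℝ} (hs : 0 ≤ s) (ht : 0 ≤ t) :
    Z.toSeminorm (s, t) ≤ s * Z.toSeminorm (1, 0) + t * Z.toSeminorm (0, 1) := by
  have h := Z.apply_add_le (s := 0) (t := t) hs
  rw [zero_add, Z.apply_right ht] at h
  linarith

theorem continuous : Continuous Z.toSeminorm :=
  Z.toSeminorm.convexOn.locallyLipschitz.continuous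

/-- Strict monotonicity in the second variable, in quantitative form: if the first coordinates `p`
and `q` together account, up to a second coordinate `e ≤ η`, for the whole of the distance
`A + B`, of which `(p, s)` and `(q, s')` may use at most `A + η` and `B + η`, then `s` is small. -/
theorem exists_tolerance (d : ℝ) {η' : ℝ} (hη' : 0 < η') :
    ∃ η > 0, ∀ p q s s' e A B : ℝ, 0 ≤ p → 0 ≤ q → 0 ≤ s' → 0 ≤ e → 0 ≤ B →
      A + B = d → Z.toSeminorm (p, s) ≤ A + η → Z.toSeminorm (q, s') ≤ B + η →
      d ≤ Z.toSeminorm (p + q, e) + η → e ≤ η → s ≤ η' := by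
  have hc₁ := Z.apply_one_zero_pos
  have hc₂ := Z.apply_zero_one_pos
  set c₁ := Z.toSeminorm (1, 0) with hc₁_def
  set c₂ := Z.toSeminorm (0, 1) with hc₂_def
  -- An upper bound `P` for `p`. The gap between `Z (p, η')` and `Z (p, 0)` decreases with `p`,
  -- and so its value `γ` at `P` bounds it below.
  set P : ℝ := max 0 ((d + 1) / c₁) with hP
  have hP0 : 0 ≤ P := le_max_left _ _
  set γ : ℝ := Z.toSeminorm (P, η') - P * c₁ with hγ
  have hγ0 : 0 < γ := by
    have h := Z.strict_mono_right P P 0 η' hP0 le_rfl le_rfl hη'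
    have h' := Z.apply_left hP0
    rw [sub_pos, ← h']
    exact h
  refine ⟨min 1 (γ / (2 * (3 + c₂))), by positivity, ?_⟩
  set η := min 1 (γ / (2 * (3 + c₂))) with hη
  have hη1 : η ≤ 1 := min_le_left _ _
  have hηγ : η * (2 * (3 + c₂)) ≤ γ := by
    rw [← le_div_iff₀ (by positivity)]; exact min_le_right _ _
  intro p q s s' e A B hp hq hs' he hB hAB h1 h2 h3 h4
  by_contra! hs
  have h5 := Z.mul_le_apply_left hp (hη'.le.trans hs.le)
  have h6 := Z.mul_le_apply_left hq hs'
  have h7 := Z.apply_le (add_nonneg hp hq) he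
  have hpP : p ≤ P := by
    refine le_trans ?_ (le_max_right _ _)
    rw [le_div_iff₀ hc₁]
    linarith
  have h8 := Z.apply_add_le (s := p) (t := η') (sub_nonneg.2 hpP)
  rw [add_sub_cancel] at h8
  have h9 := Z.mono hp le_rfl hη'.le hs.le
  have h10 : e * c₂ ≤ η * c₂ := by gcongr
  rw [← hc₁_def] at h5 h6 h7 h8
  rw [← hc₂_def] at h7
  nlinarith

end StrictlyMonotoneNorm

/-! ### Coordinates in the direct sum -/

namespace ZSum

variable {Z : StrictlyMonotoneNorm} {X Y : Type*} [NormedAddCommGroup X]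
  [NormedAddCommGroup Y]

theorem norm_def (v : ZSum Z X Y) : ‖v‖ = Z.toSeminorm (‖v.1‖, ‖v.2‖) := rfl

theorem fst_sub (u v : ZSum Z X Y) : (u - v).1 = u.1 - v.1 := rfl

theorem snd_sub (u v : ZSum Z X Y) : (u - v).2 = u.2 - v.2 := rfl

theorem norm_fst_mul_le (v : ZSum Z X Y) : ‖v.1‖ * Z.toSeminorm (1, 0) ≤ ‖v‖ :=
  Z.mul_le_apply_left (norm_nonneg _) (norm_nonneg _)

theorem norm_snd_mul_le (v : ZSum Z X Y) : ‖v.2‖ * Z.toSeminorm (0, 1) ≤ ‖v‖ :=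
  Z.mul_le_apply_right (norm_nonneg _) (norm_nonneg _)

/-- In the direct sum, iterated sums are small if those of the first coordinates are and almost
all second coordinates are. -/
theorem iteratedSumLE {l : Filter ℕ} {v : ℕ → ZSum Z X Y} {b ε : ℝ} (hε : 0 ≤ ε)
    (hv : ∀ᶠ n in l, ‖(v n).2‖ ≤ ε) {K : ℕ} : ∀ {m : ℕ} {s : ZSum Z X Y}, m ≤ K →
      ‖s.2‖ ≤ ε * (K - m) → IteratedSumLE l (fun n => (v n).1) b m s.1 →
      IteratedSumLE l v (b * Z.toSeminorm (1, 0) + ε * K * Z.toSeminorm (0, 1)) m s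
  | 0, s, _, h2, h1 => by
    change ‖_‖ ≤ _ at h1 ⊢
    rw [Nat.cast_zero, sub_zero] at h2
    refine (Z.apply_le (norm_nonneg _) (norm_nonneg _)).trans ?_
    have := Z.apply_one_zero_pos
    have := Z.apply_zero_one_pos
    gcongr
  | m + 1, s, hm, h2, h1 => by
    filter_upwards [h1, hv] with n hn1 hn2
    refine iteratedSumLE hε hv (by omega) ?_ hn1
    have h3 : ‖(s + v n).2‖ ≤ ‖s.2‖ + ‖(v n).2‖ := norm_add_le _ _
    push_cast at h2
    linarith

/-! ### Averaging near a slice of the direct sum -/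

section Slices

variable {U : Ultrafilter ℕ} {M : Set (ZSum Z X Y)} {w : ℕ → ZSum Z X Y} {a₀ : ZSum Z X Y}
  {d ε : ℝ}

/-- An averaging step that starts near the slice `{v | v.2 = a₀.2}` ends near it: the start
and `w n`, which are both near the slice, are at distance about `d`, and the end point lies
metrically between them. -/
theorem norm_snd_le_of_reachable (hd : ∀ a ∈ M, Tendsto (fun n => ‖w n - a‖) U (𝓝 d))
    (hd0 : 0 ≤ d) (hw2 : Tendsto (fun n => ‖(w n).2 - a₀.2‖) U (𝓝 0)) :
    ∀ (m j : ℕ) {η : ℝ}, 0 < η → ∃ δ > 0, ∀ a ∈ M, ∀ z : ZSum Z X Y, ‖a.2 - a₀.2‖ ≤ δ →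
      Reachable U M w d ε δ m j a z → ‖z.2 - a₀.2‖ ≤ ε / Z.toSeminorm (0, 1) + η
  | 0, _, η, hη => by
    have hc₂ := Z.apply_zero_one_pos
    set c₂ := Z.toSeminorm (0, 1)
    refine ⟨η / (1 + 1 / c₂), by positivity, fun a _ z ha h => ?_⟩
    set δ := η / (1 + 1 / c₂) with hδ
    change ‖_‖ ≤ _ at h
    have h1 : ‖a.2 - z.2‖ ≤ (ε + δ) / c₂ := by
      rw [le_div_iff₀ hc₂]
      exact (norm_snd_mul_le (a - z)).trans h
    have h2 : δ + δ / c₂ = η := by rw [hδ]; field_simp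
    have h3 := norm_sub_le_norm_sub_add_norm_sub z.2 a.2 a₀.2
    rw [norm_sub_rev z.2 a.2] at h3
    rw [add_div] at h1
    linarith
  | m + 1, j, η, hη => by
    obtain ⟨δ', hδ', ih⟩ := norm_snd_le_of_reachable hd hd0 hw2 m (j + 1) hη
    obtain ⟨η₀, hη₀, hZ⟩ := Z.exists_tolerance d (half_pos hδ')
    refine ⟨min (δ' / 2) (η₀ / 2), by positivity, fun a ha z ha2 h => ?_⟩
    set δ := min (δ' / 2) (η₀ / 2) with hδ
    have hδ0 : 0 < δ := by positivity
    have hδ1 : δ ≤ δ' / 2 := min_le_left _ _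
    have hδ2 : δ ≤ η₀ / 2 := min_le_right _ _
    obtain ⟨n, ⟨a', ha', h1, h2, h3⟩, h4, h5⟩ := (h.and (((hd a ha).eventually
      (lt_mem_nhds (sub_lt_self d hη₀))).and (hw2.eventually (gt_mem_nhds hδ0)))).exists
    have hj : (0 : ℝ) < (j : ℝ) + 1 := by positivity
    have hs : ‖(a' - a).2‖ ≤ δ' / 2 := by
      refine hZ ‖(a' - a).1‖ ‖(a' - w n).1‖ _ ‖(a' - w n).2‖ ‖(w n - a).2‖
        (1 / ((j : ℝ) + 1) * d) (j / ((j : ℝ) + 1) * d) (norm_nonneg _) (norm_nonneg _)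
        (norm_nonneg _) (norm_nonneg _) (by positivity) (by field_simp; ring) ?_ ?_ ?_ ?_
      · exact h1.trans (by linarith)
      · exact h2.trans (by linarith)
      · have h6 : ‖(w n - a).1‖ ≤ ‖(a' - a).1‖ + ‖(a' - w n).1‖ := by
          have := norm_sub_le (a' - a).1 (a' - w n).1
          rwa [fst_sub, fst_sub, sub_sub_sub_cancel_left, ← fst_sub, ← fst_sub, ← fst_sub] at this
        have h7 := Z.mono (norm_nonneg _) h6 (norm_nonneg (w n - a).2) le_rfl
        rw [norm_def] at h4
        linarith
      · have h6 := norm_sub_le ((w n).2 - a₀.2) (a.2 - a₀.2)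
        rw [sub_sub_sub_cancel_right] at h6
        rw [snd_sub]
        linarith
    refine ih a' ha' z ?_ (h3.mono (by linarith))
    have h6 := norm_sub_le_norm_sub_add_norm_sub a'.2 a.2 a₀.2
    rw [snd_sub] at hs
    linarith

/-- The first averaging step ends near `w n`, wherever it starts, and hence near the slice
`{v | v.2 = a₀.2}`; the later ones stay there. -/
theorem norm_snd_le_of_forall_reachable (hd : ∀ a ∈ M, Tendsto (fun n => ‖w n - a‖) U (𝓝 d))
    (hd0 : 0 ≤ d) (hw2 : Tendsto (fun n => ‖(w n).2 - a₀.2‖) U (𝓝 0)) {K : ℕ} (hK : 1 ≤ K)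
    {a z : ZSum Z X Y} (h : ∀ δ > 0, Reachable U M w d ε δ K 0 a z) :
    ‖z.2 - a₀.2‖ ≤ ε / Z.toSeminorm (0, 1) := by
  refine le_of_forall_pos_le_add fun η hη => ?_
  obtain ⟨m, rfl⟩ : ∃ m, K = m + 1 := ⟨K - 1, by omega⟩
  have hc₂ := Z.apply_zero_one_pos
  obtain ⟨δ', hδ', h1⟩ := norm_snd_le_of_reachable (ε := ε) hd hd0 hw2 m 1 hη
  set c₂ := Z.toSeminorm (0, 1)
  set δ := min δ' (δ' / (1 + 1 / c₂)) with hδ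
  have hδ0 : 0 < δ := by positivity
  obtain ⟨n, ⟨a', ha', -, h2, h3⟩, h4⟩ :=
    ((h δ hδ0).and (hw2.eventually (gt_mem_nhds hδ0))).exists
  refine h1 a' ha' z ?_ (h3.mono (min_le_left _ _))
  have h5 : ‖a'.2 - (w n).2‖ ≤ δ / c₂ := by
    rw [le_div_iff₀ hc₂]
    refine (norm_snd_mul_le (a' - w n)).trans ?_
    simpa using h2
  have h6 : δ + δ / c₂ ≤ δ' := by
    have h7 : δ ≤ δ' / (1 + 1 / c₂) := min_le_right _ _
    rw [le_div_iff₀ (by positivity)] at h7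
    calc δ + δ / c₂ = δ * (1 + 1 / c₂) := by ring
      _ ≤ δ' := h7
  have h8 := norm_sub_le_norm_sub_add_norm_sub a'.2 (w n).2 a₀.2
  linarith

end Slices

/-! ### The projections and completeness -/

variable (Z X Y) [NormedSpace ℝ X] [NormedSpace ℝ Y]

/-- The projection of the `Z`-direct sum onto its first summand. -/
noncomputable def fstL : ZSum Z X Y →L[ℝ] X :=
  LinearMap.mkContinuous
    { toFun := fun v => v.1, map_add' := fun _ _ => rfl, map_smul' := fun _ _ => rfl }
    (Z.toSeminorm (1, 0))⁻¹ fun v => by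
      rw [← div_eq_inv_mul, le_div_iff₀ Z.apply_one_zero_pos]
      exact norm_fst_mul_le v

/-- The projection of the `Z`-direct sum onto its second summand. -/
noncomputable def sndL : ZSum Z X Y →L[ℝ] Y :=
  LinearMap.mkContinuous
    { toFun := fun v => v.2, map_add' := fun _ _ => rfl, map_smul' := fun _ _ => rfl }
    (Z.toSeminorm (0, 1))⁻¹ fun v => by
      rw [← div_eq_inv_mul, le_div_iff₀ Z.apply_zero_one_pos]
      exact norm_snd_mul_le v

variable {Z X Y}

theorem fstL_apply (v : ZSum Z X Y) : fstL Z X Y v = v.1 := rfl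

instance [CompleteSpace X] [CompleteSpace Y] : CompleteSpace (ZSum Z X Y) := by
  refine Metric.complete_of_cauchySeq_tendsto fun u hu => ?_
  obtain ⟨a, ha⟩ := cauchySeq_tendsto_of_complete
    ((fstL Z X Y).uniformContinuous.comp_cauchySeq hu)
  obtain ⟨b, hb⟩ := cauchySeq_tendsto_of_complete
    ((sndL Z X Y).uniformContinuous.comp_cauchySeq hu)
  refine ⟨((a, b) : X × Y), tendsto_iff_norm_sub_tendsto_zero.2 ?_⟩
  have h := ((tendsto_iff_norm_sub_tendsto_zero.1 ha).mul_const (Z.toSeminorm (1, 0))).add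
    ((tendsto_iff_norm_sub_tendsto_zero.1 hb).mul_const (Z.toSeminorm (0, 1)))
  simp only [zero_mul, add_zero] at h
  exact squeeze_zero (fun _ => norm_nonneg _)
    (fun n => Z.apply_le (norm_nonneg _) (norm_nonneg _)) h

/-! ### Minimal invariant sets in the direct sum -/

/-- For a weakly convergent sequence `w` in a `Z`-direct sum that has, along an ultrafilter, the
same limit distance `d` to all its terms and to its weak limit, property asymptotic (P) of the
second summand makes the second coordinates converge in norm. The limits of `‖(w n - w m).1‖` and
`‖(w n - w m).2‖` are at least those for `w n - a`, by weak lower semicontinuity of the norms, and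
`Z` takes the value `d` at both pairs of limits; as `Z` is strictly monotone, the limits for the
second coordinates agree. -/
theorem tendsto_snd (hY : HasAsymptoticP Y) {U : Ultrafilter ℕ} (hU : (U : Filter ℕ) ≤ atTop)
    {w : ℕ → ZSum Z X Y} {a : ZSum Z X Y} {d : ℝ}
    (hwa : Tendsto (fun n => toWeakSpace ℝ _ (w n)) atTop (𝓝 (toWeakSpace ℝ _ a)))
    (hb : ∃ B, ∀ n, ‖w n‖ ≤ B)
    (hd : Tendsto (fun n => ‖w n - a‖) U (𝓝 d))
    (hdm : ∀ m, Tendsto (fun n => ‖w n - w m‖) U (𝓝 d)) :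
    Tendsto (fun n => ‖(w n).2 - a.2‖) U (𝓝 0) := by
  obtain ⟨B, hB⟩ := hb
  have hx : WeaklyNull (fun n => (w n).1 - a.1) := weaklyNull_map_sub (fstL Z X Y) hwa
  have hy : WeaklyNull (fun n => (w n).2 - a.2) := weaklyNull_map_sub (sndL Z X Y) hwa
  have hc₁ := Z.apply_one_zero_pos
  have hc₂ := Z.apply_zero_one_pos
  have hBw : ∀ c : ZSum Z X Y, ∀ n, ‖w n - c‖ ≤ B + ‖c‖ := fun c n =>
    (norm_sub_le _ _).trans (by have := hB n; linarith)
  have hlimX : ∀ c : ZSum Z X Y, ∃ r, 0 ≤ r ∧ r ≤ (B + ‖c‖) / Z.toSeminorm (1, 0) ∧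
      Tendsto (fun n => ‖(w n).1 - c.1‖) U (𝓝 r) := by
    intro c
    obtain ⟨r, hr, h⟩ := exists_tendsto_ultrafilter U (u := fun n => ‖(w n).1 - c.1‖) (a := 0)
      (b := (B + ‖c‖) / Z.toSeminorm (1, 0)) fun n => ⟨norm_nonneg _, by
        rw [le_div_iff₀ hc₁]; exact (norm_fst_mul_le (w n - c)).trans (hBw c n)⟩
    exact ⟨r, hr.1, hr.2, h⟩
  have hlimY : ∀ c : ZSum Z X Y, ∃ r, 0 ≤ r ∧ r ≤ (B + ‖c‖) / Z.toSeminorm (0, 1) ∧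
      Tendsto (fun n => ‖(w n).2 - c.2‖) U (𝓝 r) := by
    intro c
    obtain ⟨r, hr, h⟩ := exists_tendsto_ultrafilter U (u := fun n => ‖(w n).2 - c.2‖) (a := 0)
      (b := (B + ‖c‖) / Z.toSeminorm (0, 1)) fun n => ⟨norm_nonneg _, by
        rw [le_div_iff₀ hc₂]; exact (norm_snd_mul_le (w n - c)).trans (hBw c n)⟩
    exact ⟨r, hr.1, hr.2, h⟩
  have hZlim : ∀ (c : ZSum Z X Y) {r t : ℝ}, Tendsto (fun n => ‖(w n).1 - c.1‖) U (𝓝 r) →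
      Tendsto (fun n => ‖(w n).2 - c.2‖) U (𝓝 t) →
      Tendsto (fun n => ‖w n - c‖) U (𝓝 (Z.toSeminorm (r, t))) := fun c r t h1 h2 =>
    (Z.continuous.tendsto (r, t)).comp (h1.prodMk_nhds h2)
  obtain ⟨r, hr0, -, hr⟩ := hlimX a
  obtain ⟨t, ht0, -, ht⟩ := hlimY a
  choose R hR0 hRB hR using fun m => hlimX (w m)
  choose D hD0 hDB hD using fun m => hlimY (w m)
  obtain ⟨R', -, hR'⟩ := exists_tendsto_ultrafilter U (u := R) (a := 0)
    (b := (B + B) / Z.toSeminorm (1, 0)) fun m => ⟨hR0 m, (hRB m).trans (by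
      gcongr; exact hB m)⟩
  obtain ⟨D', -, hD'⟩ := exists_tendsto_ultrafilter U (u := D) (a := 0)
    (b := (B + B) / Z.toSeminorm (0, 1)) fun m => ⟨hD0 m, (hDB m).trans (by
      gcongr; exact hB m)⟩
  have hZ1 : Z.toSeminorm (r, t) = d := tendsto_nhds_unique (hZlim a hr ht) hd
  have hZ2 : Z.toSeminorm (R', D') = d := by
    have h1 : ∀ m, Z.toSeminorm (R m, D m) = d := fun m =>
      tendsto_nhds_unique (hZlim (w m) (hR m) (hD m)) (hdm m)
    have h2 := (Z.continuous.tendsto (R', D')).comp (hR'.prodMk_nhds hD')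
    refine tendsto_nhds_unique h2 ?_
    simp only [Function.comp_def, h1]
    exact tendsto_const_nhds
  have hwa' := hwa.mono_left hU
  have hrR : r ≤ R' := le_of_tendsto_of_tendsto' hr hR' 
    (norm_map_sub_le_of_tendsto_toWeakSpace hwa' (fstL Z X Y) hR)
  have htD : t ≤ D' := le_of_tendsto_of_tendsto' ht hD' 
    (norm_map_sub_le_of_tendsto_toWeakSpace hwa' (sndL Z X Y) hD)
  have htD' : t = D' := by
    by_contra hne
    have h := Z.strict_mono_right r R' t D' hr0 hrR ht0 (lt_of_le_of_ne htD hne)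
    change Z.toSeminorm (r, t) < Z.toSeminorm (R', D') at h
    rw [hZ1, hZ2] at h
    exact lt_irrefl _ h
  have h0 : t = 0 := hY.eq_zero hy hU (L := D) (fun m => by simpa using hD m) (htD' ▸ hD') ht
  rwa [h0] at ht

/-- A minimal invariant set lies in a single translate of the first summand. -/
theorem exists_snd_eq [CompleteSpace X] [CompleteSpace Y] (hX : HasWeakBanachSaks X)
    (hY : HasAsymptoticP Y) {T : ZSum Z X Y → ZSum Z X Y} {M : Set (ZSum Z X Y)}
    (hM : IsMinimalInvariant T M) (hT : NonexpansiveSelfMap T M)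
    (hMc : IsCompact (toWeakSpace ℝ (ZSum Z X Y) '' M)) : ∃ y : Y, ∀ z ∈ M, z.2 = y := by
  have hb := isBounded_of_isCompact_toWeakSpace hMc
  have hc₁ := Z.apply_one_zero_pos
  have hc₂ := Z.apply_zero_one_pos
  obtain ⟨w, hw, hwT, a, ha, hwa⟩ : ∃ w : ℕ → ZSum Z X Y, (∀ n, w n ∈ M) ∧
      Tendsto (fun n => ‖T (w n) - w n‖) atTop (𝓝 0) ∧ ∃ a ∈ M,
        Tendsto (fun n => toWeakSpace ℝ _ (w n)) atTop (𝓝 (toWeakSpace ℝ _ a)) := by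
    choose w hw hwT using fun n : ℕ => hT.exists_norm_sub_le hM.nonempty hM.convex hM.isClosed hb
      (show (0 : ℝ) < 1 / ((n : ℝ) + 1) by positivity)
    obtain ⟨φ, hφ, a, ha, hwa⟩ := exists_subseq_tendsto_toWeakSpace hMc hw
    exact ⟨fun n => w (φ n), fun n => hw _,
      (squeeze_zero (fun _ => norm_nonneg _) hwT tendsto_one_div_add_atTop_nhds_zero_nat).comp
        hφ.tendsto_atTop, a, ha, hwa⟩
  let U : Ultrafilter ℕ := hyperfilter ℕ
  have hU : (U : Filter ℕ) ≤ atTop := Nat.hyperfilter_le_atTop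
  have hwTU := hwT.mono_left hU
  set d := Metric.diam M
  have hd : ∀ z ∈ M, Tendsto (fun n => ‖w n - z‖) U (𝓝 d) := fun z hz =>
    hM.tendsto_norm_sub hT hb U hw hwTU ha (hwa.mono_left hU) hz
  have hdle : ∀ x ∈ M, ∀ y ∈ M, ‖x - y‖ ≤ d := fun x hx y hy => by
    rw [← dist_eq_norm]; exact Metric.dist_le_diam_of_mem hb hx hy
  obtain ⟨B, hB⟩ := hb.exists_norm_le
  have hw2 := tendsto_snd hY hU hwa ⟨B, fun n => hB _ (hw n)⟩ (hd a ha) fun m => hd _ (hw m)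
  have hx : WeaklyNull (fun n => (w n).1 - a.1) := weaklyNull_map_sub (fstL Z X Y) hwa
  refine ⟨a.2, fun z hz => ?_⟩
  have hle : ∀ ε > 0, ‖z.2 - a.2‖ ≤ ε := by
    intro ε hε
    -- Means with coordinates of norm at most `ρ` have norm at most `ε * Z (0, 1)`.
    set c₁ := Z.toSeminorm (1, 0)
    set c₂ := Z.toSeminorm (0, 1)
    set ρ : ℝ := ε * c₂ / (c₁ + c₂) with hρ
    have hρ0 : 0 < ρ := by positivity
    obtain ⟨K, hK, hsum⟩ := hX.exists_iteratedSumLE hx hU hρ0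
    have hsum' : IteratedSumLE (U : Filter ℕ) (fun n => w n - a) (ε * c₂ * K) K
        (((0 : ℕ) : ℝ) • (a - a)) := by
      have h := iteratedSumLE (l := U) (v := fun n => w n - a) (b := ρ * K) hρ0.le
        (hw2.eventually (ge_mem_nhds hρ0)) (K := K) (m := K) (s := 0) le_rfl
        (by rw [sub_self, mul_zero]; exact norm_zero.le) hsum
      have h1 : ρ * K * c₁ + ρ * K * c₂ = ε * c₂ * K := by rw [hρ]; field_simp
      rw [Nat.cast_zero, zero_smul, ← h1]
      exact h
    have hdense := hM.subset_closure_reachable hT hw hwTU (d := d) (ε := ε * c₂) (K := K)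
      ⟨a, ha, a, ha, fun δ hδ =>
        Reachable.of_iteratedSumLE hM.convex hw hdle hδ.le hK ha (zero_add K) hsum'⟩
    have hclosed : IsClosed {v : ZSum Z X Y | ‖v.2 - a.2‖ ≤ ε} :=
      isClosed_le ((sndL Z X Y).continuous.sub continuous_const).norm continuous_const
    refine closure_minimal ?_ hclosed (hdense hz)
    rintro v ⟨-, a', -, h⟩
    have h1 := norm_snd_le_of_forall_reachable hd Metric.diam_nonneg hw2 hK h
    rwa [mul_div_cancel_right₀ _ hc₂.ne'] at h1
  exact sub_eq_zero.1 (norm_le_zero_iff.1 (le_of_forall_pos_le_add fun ε hε => by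
    simpa using hle ε hε))

/-- The weak fixed point property of `X` applies in the translates of `X` in a direct sum. -/
theorem exists_fixedPoint_of_snd_eq (hX : HasWFPP X) {T : ZSum Z X Y → ZSum Z X Y}
    {M : Set (ZSum Z X Y)} (hne : M.Nonempty) (hconv : Convex ℝ M)
    (hMc : IsCompact (toWeakSpace ℝ (ZSum Z X Y) '' M)) (hT : NonexpansiveSelfMap T M) {y : Y}
    (hy : ∀ z ∈ M, z.2 = y) : ∃ z ∈ M, T z = z := by
  let i : X → ZSum Z X Y := fun x => ((x, y) : X × Y)
  have hi : ∀ z ∈ M, i z.1 = z := fun z hz => Prod.ext rfl (hy z hz).symm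
  have hmem : ∀ x ∈ fstL Z X Y '' M, i x ∈ M := by
    rintro _ ⟨z, hz, rfl⟩
    rw [fstL_apply, hi z hz]
    exact hz
  have hnorm : ∀ u v : X, ‖i u - i v‖ = ‖u - v‖ * Z.toSeminorm (1, 0) := by
    intro u v
    have h : ‖y - y‖ = 0 := by rw [sub_self, norm_zero]
    rw [← Z.apply_left (norm_nonneg _), ← h]
    rfl
  have hcomp : IsCompact (toWeakSpace ℝ X '' (fstL Z X Y '' M)) := by
    have h := hMc.image (WeakSpace.map (fstL Z X Y)).continuous
    rw [Set.image_image] at h ⊢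
    exact h
  obtain ⟨x, hx, hTx⟩ := hX (fstL Z X Y '' M) (hne.image _)
    (hconv.linear_image (fstL Z X Y).toLinearMap) hcomp (fun x => (T (i x)).1)
    (fun x hx => ⟨T (i x), hT.mapsTo (hmem x hx), rfl⟩) (fun u hu v hv => by
      have h := hT.norm_le _ (hmem u hu) _ (hmem v hv)
      rw [hnorm] at h
      exact le_of_mul_le_mul_right ((norm_fst_mul_le (T (i u) - T (i v))).trans h)
        Z.apply_one_zero_pos)
  refine ⟨i x, hmem x hx, ?_⟩
  rw [← hi _ (hT.mapsTo (hmem x hx)), hTx]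

end ZSum

theorem theorem1 (X Y : Type*) [NormedAddCommGroup X] [NormedSpace ℝ X] [CompleteSpace X]
    [NormedAddCommGroup Y] [NormedSpace ℝ Y] [CompleteSpace Y]
    (hXBS : HasWeakBanachSaks X) (hXfix : HasWFPP X) (hY : HasAsymptoticP Y)
    (Z : StrictlyMonotoneNorm) :
    HasWFPP (ZSum Z X Y) := by
  intro C hne hconv hC T hTC hT
  obtain ⟨M, hMC, hM⟩ := exists_isMinimalInvariant hne hconv hC hTC
  have hTM : NonexpansiveSelfMap T M := NonexpansiveSelfMap.mono ⟨hTC, hT⟩ hMC hM.mapsTo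
  have hMc := isCompact_toWeakSpace_of_subset hC hMC hM.convex hM.isClosed
  obtain ⟨y, hy⟩ := ZSum.exists_snd_eq hXBS hY hM hTM hMc
  obtain ⟨z, hz, hTz⟩ := ZSum.exists_fixedPoint_of_snd_eq hXfix hM.nonempty hM.convex hMc hTM hy
  exact ⟨z, hMC hz, hTz⟩
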